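/- Let $(\Omega,\mathcal F,\mathbb P)$ be an atomless probability space, let $0<\tau\le\frac12$, put $\beta=\frac{1-\tau}{\tau}\ge 1$, and let $\xi\in L^\infty(\Omega,\mathcal F,\mathbb P)$ be real valued. The expectile $e_\tau(\xi)$ is the minimiser over $l\in\mathbb R$ of $$\phi_{\tau,\xi}(l)=\tau\,\mathbb E\big[((\xi-l)^+)^2\big]+(1-\tau)\,\mathbb E\big[((l-\xi)^+)^2\big].$$ For $0<\alpha\le 1$ the tail expectation at level $\alpha$ is $$u_\alpha(\xi)=\inf\Big\{\mathbb E_{\mathbb Q}[\xi]\;:\;\mathbb Q\ll\mathbb P\text{ a probability measure},\ \frac{d\mathbb Q}{d\mathbb P}\le\frac1\alpha\ \ \mathbb P\text{-a.s.}\Big\}.$$ Let $\mathcal S$ be the set of all Borel probability measures $\nu$ on $(0,1]$ with $$\int_{(0,1]}\frac1u\,\nu(du)\le\beta\,\nu(\{1\}).$$ Then the minimiser defining $e_\tau(\xi)$ exists and is unique, $\alpha\mapsto u_\alpha(\xi)$ is $\nu$-integrable on $(0,1]$ for every $\nu\in\mathcal S$, and $$e_\tau(\xi)=\inf\Big\{\int_{(0,1]}u_\alpha(\xi)\,\nu(d\alpha)\;:\;\nu\in\mathcal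 S\Big\}.$$ -/

import Mathlib

open MeasureTheory Set
open scoped ENNReal

noncomputable section

/-- A measure is atomless: every measurable set of positive measure contains a measurable subset
of strictly smaller positive measure. (Mathlib's `NoAtoms` only says that points are null.) -/
def IsAtomless {Ω : Type*} [MeasurableSpace Ω] (P : Measure Ω) : Prop :=
  ∀ A : Set Ω, MeasurableSet A → 0 < P A →
    ∃ B : Set Ω, MeasurableSet B ∧ B ⊆ A ∧ 0 < P B ∧ P B < P A

/-- The function `l ↦ τ E[((ξ - l)⁺)²] + (1 - τ) E[((l - ξ)⁺)²]`. -/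
def expectileLoss {Ω : Type*} [MeasurableSpace Ω] (P : Measure Ω) (τ : ℝ) (ξ : Ω → ℝ) (l : ℝ) :
    ℝ :=
  τ * (∫ ω, ((ξ ω - l)⁺) ^ 2 ∂P) + (1 - τ) * (∫ ω, ((l - ξ ω)⁺) ^ 2 ∂P)

/-- The expectile `e_τ(ξ)`: the argument at which the loss attains its minimum over `ℝ`. -/
def expectile {Ω : Type*} [MeasurableSpace Ω] (P : Measure Ω) (τ : ℝ) (ξ : Ω → ℝ) : ℝ :=
  Classical.epsilon fun l : ℝ => IsMinOn (expectileLoss P τ ξ) univ l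

/-- The scenario set of the tail expectation at level `α`: the probability measures `Q ≪ P` with
`dQ/dP ≤ 1/α`. The inverse is taken in `[0, ∞]`, so for `α = 0` there is no bound on the density. -/
def tailScenarios {Ω : Type*} [MeasurableSpace Ω] (P : Measure Ω) (α : ℝ) : Set (Measure Ω) :=
  {Q | IsProbabilityMeasure Q ∧ Q ≪ P ∧ ∀ᵐ ω ∂P, Q.rnDeriv P ω ≤ (ENNReal.ofReal α)⁻¹}

/-- The tail expectation `u_α(ξ)`: the infimum of `E_Q[ξ]` over the scenario set at level `α`. -/
def tailExpectation {Ω : Type*} [MeasurableSpace Ω] (P : Measure Ω) (α : ℝ) (ξ : Ω → ℝ) : ℝ :=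
  sInf ((fun Q : Measure Ω => ∫ ω, ξ ω ∂Q) '' tailScenarios P α)

/-- The probability measures `ν` on `(0, 1]` with `∫_{(0,1]} (1/u) ν(du) ≤ β ν({1})`. The
integral takes values in `[0, ∞]`. -/
def kusuokaSet (β : ℝ) : Set (Measure ℝ) :=
  {ν | IsProbabilityMeasure ν ∧ ν (Ioc (0 : ℝ) 1)ᶜ = 0 ∧
    ∫⁻ u in Ioc (0 : ℝ) 1, ENNReal.ofReal (1 / u) ∂ν ≤ ENNReal.ofReal β * ν {1}}

end

open MeasureTheory Set
open scoped ENNReal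

/-! The first order condition says that `e` is the expectile iff `E(ξ - e)⁺ = β M`, where `M = E(e -
ξ)⁺`; equivalently `E ξ = e + (β - 1) M`. A density bound `1/α` gives `u_α ≥ e - M/α`, and `u_1 = E
ξ` exceeds this bound at `α = 1` by exactly `β M`. Integrating against `ν`, the constraint on `ν` is
precisely what makes the `M` terms nonnegative (`le_integral_tailExpectation`). Conversely,
conditioning on `ξ < e` gives `u_p ≤ e - M/p` with `p = P(ξ < e)` (`exists_tailExpectation_le`), and
a measure on `{p, 1}` attains the infimum (`exists_mem_kusuokaSet`). -/

/-- Quadratic growth of the asymmetric square loss around a point `x`. -/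
theorem asymmetric_sq_growth {τ : ℝ} (hτ' : τ ≤ 1 / 2) (x e l : ℝ) :
    τ * ((x - e)⁺) ^ 2 + (1 - τ) * ((e - x)⁺) ^ 2
      - 2 * (l - e) * (τ * (x - e)⁺ - (1 - τ) * (e - x)⁺) + τ * (l - e) ^ 2
      ≤ τ * ((x - l)⁺) ^ 2 + (1 - τ) * ((l - x)⁺) ^ 2 := by
  -- In `l` the loss has curvature `2τ` or `2(1 - τ)`, hence at least `2τ`. The cases record the
  -- side of `e` and of `l` on which `x` lies.
  simp only [posPart_def]
  rcases le_total x e with h | h <;> rcases le_total x l with h' | h'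
  · rw [sup_of_le_right (by linarith : x - e ≤ 0), sup_of_le_left (by linarith : 0 ≤ e - x),
      sup_of_le_right (by linarith : x - l ≤ 0), sup_of_le_left (by linarith : 0 ≤ l - x)]
    nlinarith [mul_nonneg (by linarith : 0 ≤ 1 - 2 * τ) (sq_nonneg (l - e))]
  · rw [sup_of_le_right (by linarith : x - e ≤ 0), sup_of_le_left (by linarith : 0 ≤ e - x),
      sup_of_le_left (by linarith : 0 ≤ x - l), sup_of_le_right (by linarith : l - x ≤ 0)]
    nlinarith [mul_nonneg (mul_nonneg (by linarith : 0 ≤ 1 - 2 * τ)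
        (by linarith : 0 ≤ e - x)) (by linarith : 0 ≤ x - l),
      mul_nonneg (by linarith : 0 ≤ 1 - 2 * τ) (sq_nonneg (e - x))]
  · rw [sup_of_le_left (by linarith : 0 ≤ x - e), sup_of_le_right (by linarith : e - x ≤ 0),
      sup_of_le_right (by linarith : x - l ≤ 0), sup_of_le_left (by linarith : 0 ≤ l - x)]
    nlinarith [mul_nonneg (by linarith : 0 ≤ 1 - 2 * τ) (sq_nonneg (l - x))]
  · rw [sup_of_le_left (by linarith : 0 ≤ x - e), sup_of_le_right (by linarith : e - x ≤ 0),
      sup_of_le_left (by linarith : 0 ≤ x - l), sup_of_le_right (by linarith : l - x ≤ 0)]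
    nlinarith

section

variable {Ω : Type*} [MeasurableSpace Ω] {P : Measure Ω} {ξ : Ω → ℝ}

theorem integrable_posPart_sub [IsFiniteMeasure P] (hξ : Integrable ξ P) (l : ℝ) :
    Integrable (fun ω => (ξ ω - l)⁺) P :=
  (hξ.sub (integrable_const l)).pos_part

theorem integrable_posPart_sub' [IsFiniteMeasure P] (hξ : Integrable ξ P) (l : ℝ) :
    Integrable (fun ω => (l - ξ ω)⁺) P :=
  ((integrable_const l).sub hξ).pos_part

theorem MeasureTheory.MemLp.posPart_real {p : ℝ≥0∞} {f : Ω → ℝ} (hf : MemLp f p P) :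
    MemLp (fun ω => (f ω)⁺) p P := by
  refine hf.of_le (continuous_posPart.comp_aestronglyMeasurable hf.1) (.of_forall fun ω => ?_)
  rw [Real.norm_of_nonneg (posPart_nonneg _)]
  exact sup_le (le_abs_self _) (abs_nonneg _)

theorem MeasureTheory.MemLp.exists_ae_norm_le (hξ : MemLp ξ ∞ P) :
    ∃ C : ℝ, ∀ᵐ ω ∂P, ‖ξ ω‖ ≤ C := by
  obtain ⟨C, hC⟩ : Filter.IsBoundedUnder (· ≤ ·) (ae P) fun ω => ‖ξ ω‖₊ :=
    eLpNormEssSup_lt_top_iff_isBoundedUnder.1 (by simpa using hξ.2)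
  exact ⟨C, hC⟩

theorem integrable_posPart_sub_sq [IsFiniteMeasure P] (hξ : MemLp ξ ∞ P) (l : ℝ) :
    Integrable (fun ω => ((ξ ω - l)⁺) ^ 2) P :=
  (((hξ.sub (memLp_const l)).posPart_real).mono_exponent le_top).integrable_sq

theorem integrable_posPart_sub_sq' [IsFiniteMeasure P] (hξ : MemLp ξ ∞ P) (l : ℝ) :
    Integrable (fun ω => ((l - ξ ω)⁺) ^ 2) P :=
  ((((memLp_const l).sub hξ).posPart_real).mono_exponent le_top).integrable_sq

/-! ### The expectile as a balance point -/

/-- A real number balances the two partial moments as required by the first order condition. -/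
theorem exists_balance [IsProbabilityMeasure P] {τ : ℝ} (hτ : 0 < τ) (hτ' : τ ≤ 1 / 2)
    (hξ : MemLp ξ ∞ P) :
    ∃ e : ℝ, τ * ∫ ω, (ξ ω - e)⁺ ∂P = (1 - τ) * ∫ ω, (e - ξ ω)⁺ ∂P := by
  have hi : Integrable ξ P := hξ.integrable le_top
  obtain ⟨C, hC⟩ := hξ.exists_ae_norm_le
  have h0 : 0 ≤ C := by
    obtain ⟨ω, hω⟩ := hC.exists
    exact (norm_nonneg _).trans hω
  have hcont : ∀ s : ℝ → Ω → ℝ, (∀ l, Integrable (s l) P) →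
      (∀ ω l l', |s l ω - s l' ω| ≤ |l - l'|) → Continuous fun l => ∫ ω, s l ω ∂P := by
    intro s hs hl
    refine (LipschitzWith.of_dist_le_mul (K := 1) fun l l' => ?_).continuous
    rw [Real.dist_eq, ← integral_sub (hs l) (hs l'), NNReal.coe_one, one_mul, Real.dist_eq]
    calc _ ≤ ∫ ω, |s l ω - s l' ω| ∂P := abs_integral_le_integral_abs
      _ ≤ ∫ _, |l - l'| ∂P :=
        integral_mono ((hs l).sub (hs l')).abs (integrable_const _) fun ω => hl ω l l'
      _ = _ := by simp
  have hpp : ∀ a b : ℝ, |a⁺ - b⁺| ≤ |a - b| := fun a b => by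
    simpa [posPart_def] using abs_sup_sub_sup_le_abs a b 0
  have h1 := hcont (fun l ω => (ξ ω - l)⁺) (integrable_posPart_sub hi) fun ω l l' =>
    (hpp _ _).trans (by rw [show ξ ω - l - (ξ ω - l') = -(l - l') by ring, abs_neg])
  have h2 := hcont (fun l ω => (l - ξ ω)⁺) (integrable_posPart_sub' hi) fun ω l l' =>
    (hpp _ _).trans (by rw [show l - ξ ω - (l' - ξ ω) = l - l' by ring])
  have hle : ∀ᵐ ω ∂P, (-C - ξ ω)⁺ = 0 := by
    filter_upwards [hC] with ω hω
    exact posPart_eq_zero.2 (by linarith [(abs_le.1 hω).1])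
  have hge : ∀ᵐ ω ∂P, (ξ ω - C)⁺ = 0 := by
    filter_upwards [hC] with ω hω
    exact posPart_eq_zero.2 (by linarith [(abs_le.1 hω).2])
  -- Almost surely `-C ≤ ξ ≤ C`, so one partial moment vanishes at each endpoint and the signs are
  -- opposite.
  have hivt := intermediate_value_Icc' (by linarith : -C ≤ C)
    (f := fun l => τ * ∫ ω, (ξ ω - l)⁺ ∂P - (1 - τ) * ∫ ω, (l - ξ ω)⁺ ∂P)
    (by fun_prop)
  obtain ⟨e, -, he⟩ := hivt (show (0 : ℝ) ∈ _ by
    constructor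
    · simp only [integral_congr_ae hge, integral_zero, mul_zero, zero_sub, neg_nonpos]
      exact mul_nonneg (by linarith) (integral_nonneg fun _ => posPart_nonneg _)
    · simp only [integral_congr_ae hle, integral_zero, mul_zero, sub_zero]
      exact mul_nonneg hτ.le (integral_nonneg fun _ => posPart_nonneg _))
  exact ⟨e, sub_eq_zero.1 he⟩

/-- The linear term of the pointwise bound integrates to zero by the balance at `e`. The quadratic
remainder yields both minimality and uniqueness. -/
theorem expectileLoss_growth [IsProbabilityMeasure P] {τ : ℝ} (hτ' : τ ≤ 1 / 2)
    (hξ : MemLp ξ ∞ P) {e : ℝ}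
    (he : τ * ∫ ω, (ξ ω - e)⁺ ∂P = (1 - τ) * ∫ ω, (e - ξ ω)⁺ ∂P) (l : ℝ) :
    expectileLoss P τ ξ e + τ * (l - e) ^ 2 ≤ expectileLoss P τ ξ l := by
  have hi : Integrable ξ P := hξ.integrable le_top
  have a1 := fun l => (integrable_posPart_sub_sq hξ l).const_mul τ
  have a2 := fun l => (integrable_posPart_sub_sq' hξ l).const_mul (1 - τ)
  have b1 := (integrable_posPart_sub hi e).const_mul τ
  have b2 := (integrable_posPart_sub' hi e).const_mul (1 - τ)
  have key := integral_mono
    ((((a1 e).add (a2 e)).sub ((b1.sub b2).const_mul (2 * (l - e)))).add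
      (integrable_const (τ * (l - e) ^ 2))) ((a1 l).add (a2 l))
    (fun ω => asymmetric_sq_growth hτ' (ξ ω) e l)
  rw [integral_add' (((a1 e).add (a2 e)).sub ((b1.sub b2).const_mul (2 * (l - e))))
      (integrable_const _), integral_sub' ((a1 e).add (a2 e)) ((b1.sub b2).const_mul _),
    integral_add' (a1 e) (a2 e), integral_add' (a1 l) (a2 l), integral_const_mul (2 * (l - e))] at key
  have hs : ∫ ω, ((fun ω => τ * (ξ ω - e)⁺) - fun ω => (1 - τ) * (e - ξ ω)⁺) ω ∂P = 0 := by
    rw [integral_sub' b1 b2, integral_const_mul, integral_const_mul, he, sub_self]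
  rw [hs] at key
  simpa [expectileLoss, integral_const_mul] using key

theorem isMinOn_expectileLoss_iff [IsProbabilityMeasure P] {τ : ℝ} (hτ : 0 < τ)
    (hτ' : τ ≤ 1 / 2) (hξ : MemLp ξ ∞ P) {e : ℝ}
    (he : τ * ∫ ω, (ξ ω - e)⁺ ∂P = (1 - τ) * ∫ ω, (e - ξ ω)⁺ ∂P) (l : ℝ) :
    IsMinOn (expectileLoss P τ ξ) univ l ↔ l = e := by
  have hg := expectileLoss_growth hτ' hξ he
  constructor
  · intro h
    have h1 : expectileLoss P τ ξ l ≤ expectileLoss P τ ξ e := h (mem_univ e)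
    have h2 : (l - e) ^ 2 = 0 := by nlinarith [hg l, sq_nonneg (l - e)]
    exact sub_eq_zero.1 (pow_eq_zero_iff two_ne_zero |>.1 h2)
  · rintro rfl x -
    have := hg x
    have := mul_nonneg hτ.le (sq_nonneg (x - l))
    simp only [mem_ofPred_eq]
    linarith

/-! ### Tail expectations -/

theorem self_mem_tailScenarios [IsProbabilityMeasure P] {α : ℝ} (hα : α ≤ 1) :
    P ∈ tailScenarios P α := by
  refine ⟨inferInstance, Measure.AbsolutelyContinuous.rfl, ?_⟩
  filter_upwards [P.rnDeriv_self] with ω hω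
  rw [hω, ENNReal.one_le_inv]
  exact ENNReal.ofReal_le_one.2 hα

theorem le_smul_of_mem_tailScenarios [IsProbabilityMeasure P] {α : ℝ} {Q : Measure Ω}
    (hQ : Q ∈ tailScenarios P α) : Q ≤ (ENNReal.ofReal α)⁻¹ • P := by
  obtain ⟨h1, h2, h3⟩ := hQ
  rw [← Measure.withDensity_rnDeriv_eq Q P h2, ← withDensity_const]
  exact withDensity_mono h3

theorem cond_mem_tailScenarios [IsProbabilityMeasure P] {A : Set Ω} (hA : MeasurableSet A)
    (h0 : P A ≠ 0) : ProbabilityTheory.cond P A ∈ tailScenarios P (P A).toReal := by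
  refine ⟨ProbabilityTheory.cond_isProbabilityMeasure h0,
    ProbabilityTheory.cond_absolutelyContinuous, ?_⟩
  have h : ProbabilityTheory.cond P A = P.withDensity (A.indicator fun _ => (P A)⁻¹) := by
    rw [withDensity_indicator hA, withDensity_const]; rfl
  rw [h]
  filter_upwards [Measure.rnDeriv_withDensity P (f := A.indicator fun _ => (P A)⁻¹)
    (measurable_const.indicator hA)] with ω hω
  rw [hω, ENNReal.ofReal_toReal (measure_ne_top _ _)]
  exact indicator_le_self' (fun _ _ => zero_le) ω

theorem abs_integral_le_of_mem_tailScenarios {α : ℝ} {C : ℝ} (hC : ∀ᵐ ω ∂P, ‖ξ ω‖ ≤ C) :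
    ∀ Q ∈ tailScenarios P α, |∫ ω, ξ ω ∂Q| ≤ C := by
  rintro Q ⟨h1, h2, -⟩
  simpa using norm_integral_le_of_norm_le_const (h2.ae_le hC)

theorem bddBelow_image_tailScenarios (hξ : MemLp ξ ∞ P) (α : ℝ) :
    BddBelow ((fun Q : Measure Ω => ∫ ω, ξ ω ∂Q) '' tailScenarios P α) := by
  obtain ⟨C, hC⟩ := hξ.exists_ae_norm_le
  refine ⟨-C, ?_⟩
  rintro _ ⟨Q, hQ, rfl⟩
  exact (abs_le.1 (abs_integral_le_of_mem_tailScenarios hC Q hQ)).1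

theorem tailExpectation_le (hξ : MemLp ξ ∞ P) {α : ℝ} {Q : Measure Ω}
    (hQ : Q ∈ tailScenarios P α) : tailExpectation P α ξ ≤ ∫ ω, ξ ω ∂Q :=
  csInf_le (bddBelow_image_tailScenarios hξ α) (mem_image_of_mem _ hQ)

theorem le_tailExpectation [IsProbabilityMeasure P] {α c : ℝ} (hα : α ≤ 1)
    (h : ∀ Q ∈ tailScenarios P α, c ≤ ∫ ω, ξ ω ∂Q) : c ≤ tailExpectation P α ξ := by
  refine le_csInf ⟨_, mem_image_of_mem _ (self_mem_tailScenarios hα)⟩ ?_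
  rintro _ ⟨Q, hQ, rfl⟩
  exact h Q hQ

theorem tailExpectation_mono [IsProbabilityMeasure P] (hξ : MemLp ξ ∞ P) {α α' : ℝ}
    (h : α ≤ α') (hα' : α' ≤ 1) : tailExpectation P α ξ ≤ tailExpectation P α' ξ := by
  refine le_tailExpectation hα' fun Q hQ => tailExpectation_le hξ ⟨hQ.1, hQ.2.1, ?_⟩
  filter_upwards [hQ.2.2] with ω hω
  exact hω.trans (ENNReal.inv_le_inv.2 (ENNReal.ofReal_le_ofReal h))

theorem integrableOn_tailExpectation [IsProbabilityMeasure P] (hξ : MemLp ξ ∞ P)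
    (ν : Measure ℝ) [IsFiniteMeasure ν] :
    IntegrableOn (fun α : ℝ => tailExpectation P α ξ) (Ioc 0 1) ν := by
  obtain ⟨C, hC⟩ := hξ.exists_ae_norm_le
  -- Measurability in `α` comes from monotonicity.
  have hm : AEMeasurable (fun α : ℝ => tailExpectation P α ξ) (ν.restrict (Ioc 0 1)) :=
    aemeasurable_restrict_of_monotoneOn measurableSet_Ioc
      fun a _ b hb hab => tailExpectation_mono hξ hab hb.2
  refine Integrable.of_bound hm.aestronglyMeasurable C ?_
  filter_upwards [ae_restrict_mem measurableSet_Ioc] with α hα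
  have hP := self_mem_tailScenarios (P := P) hα.2
  refine abs_le.2 ⟨le_tailExpectation hα.2 fun Q hQ =>
    (abs_le.1 (abs_integral_le_of_mem_tailScenarios hC Q hQ)).1, ?_⟩
  exact (tailExpectation_le hξ hP).trans
    (abs_le.1 (abs_integral_le_of_mem_tailScenarios hC P hP)).2

theorem tailExpectation_one [IsProbabilityMeasure P] (hξ : MemLp ξ ∞ P) :
    tailExpectation P 1 ξ = ∫ ω, ξ ω ∂P := by
  refine (tailExpectation_le hξ (self_mem_tailScenarios le_rfl)).antisymm
    (le_tailExpectation le_rfl fun Q hQ => ?_)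
  have := hQ.1
  have h : Q = P := Measure.eq_of_le_of_measure_univ_eq
    (by simpa using le_smul_of_mem_tailScenarios hQ) (by simp)
  rw [h]

/-- Integrate `ξ ≥ e - (e - ξ)⁺` under `Q`, then use `Q ≤ P/α` on the nonnegative part. -/
theorem sub_le_tailExpectation [IsProbabilityMeasure P] (hξ : MemLp ξ ∞ P) (e : ℝ) {α : ℝ}
    (hα : α ∈ Ioc (0 : ℝ) 1) :
    e - (∫ ω, (e - ξ ω)⁺ ∂P) * (1 / α) ≤ tailExpectation P α ξ := by
  refine le_tailExpectation hα.2 fun Q hQ => ?_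
  have := hQ.1
  obtain ⟨C, hC⟩ := hξ.exists_ae_norm_le
  have hξQ : Integrable ξ Q :=
    Integrable.of_bound (hξ.1.mono_ac hQ.2.1) C (hQ.2.1.ae_le hC)
  have hc : (ENNReal.ofReal α)⁻¹ ≠ ∞ := by simpa using hα.1
  have h1 : ∫ ω, (e - ξ ω)⁺ ∂Q ≤ (1 / α) * ∫ ω, (e - ξ ω)⁺ ∂P := by
    refine (integral_mono_measure (le_smul_of_mem_tailScenarios hQ)
      (.of_forall fun _ => posPart_nonneg _)
      ((integrable_posPart_sub' (hξ.integrable le_top) e).smul_measure hc)).trans_eq ?_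
    rw [integral_smul_measure, ENNReal.toReal_inv, ENNReal.toReal_ofReal hα.1.le, smul_eq_mul,
      one_div]
  have h2 : e - ∫ ω, ξ ω ∂Q ≤ ∫ ω, (e - ξ ω)⁺ ∂Q := by
    calc e - ∫ ω, ξ ω ∂Q = ∫ ω, (e - ξ ω) ∂Q := by
          rw [integral_sub (integrable_const _) hξQ]; simp
      _ ≤ _ := integral_mono ((integrable_const _).sub hξQ) (integrable_posPart_sub' hξQ e)
          fun ω => le_posPart _
  linarith

/-- The lower tail below `e` has a level `p` at which the tail expectation is at most
`e - E[(e - ξ)⁺] / p`. -/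
theorem exists_tailExpectation_le [IsProbabilityMeasure P] (hξ : MemLp ξ ∞ P) (e : ℝ)
    (he : ∫ ω, (e - ξ ω)⁺ ∂P = 0 → ∫ ω, ξ ω ∂P ≤ e) :
    ∃ p ∈ Ioc (0 : ℝ) 1, tailExpectation P p ξ ≤ e - (∫ ω, (e - ξ ω)⁺ ∂P) * (1 / p) := by
  have hi : Integrable ξ P := hξ.integrable le_top
  set A : Set Ω := {ω | hξ.1.mk ξ ω < e}
  have hA : MeasurableSet A :=
    measurableSet_lt hξ.1.stronglyMeasurable_mk.measurable measurable_const
  have hM : ∫ ω, (e - ξ ω)⁺ ∂P = ∫ ω in A, (e - ξ ω) ∂P := by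
    rw [← integral_indicator hA]
    refine integral_congr_ae ?_
    filter_upwards [hξ.1.ae_eq_mk] with ω hω
    by_cases h : hξ.1.mk ξ ω < e
    · rw [indicator_of_mem (show ω ∈ A from h), posPart_eq_self.2 (by linarith)]
    · rw [indicator_of_notMem (show ω ∉ A from h), posPart_eq_zero.2 (by linarith)]
  by_cases h0 : P A = 0
  · have hM0 : ∫ ω, (e - ξ ω)⁺ ∂P = 0 := by rw [hM, setIntegral_measure_zero _ h0]
    -- With no mass below `e` there is nothing to condition on; since `M = 0`, level `1` serves.
    refine ⟨1, by simp, ?_⟩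
    rw [tailExpectation_one hξ, hM0, zero_mul, sub_zero]
    exact he hM0
  · have hp : 0 < (P A).toReal := ENNReal.toReal_pos h0 (measure_ne_top _ _)
    refine ⟨(P A).toReal, ⟨hp, measureReal_le_one⟩, ?_⟩
    refine (tailExpectation_le hξ (cond_mem_tailScenarios hA h0)).trans_eq ?_
    rw [ProbabilityTheory.cond, integral_smul_measure, hM,
      integral_sub (integrable_const _) hi.integrableOn, setIntegral_const, ENNReal.toReal_inv,
      smul_eq_mul, smul_eq_mul, Measure.real]
    field_simp
    ring

/-! ### Mixtures of tail expectations -/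

theorem integral_sub_eq [IsProbabilityMeasure P] (hi : Integrable ξ P) (e : ℝ) :
    ∫ ω, ξ ω ∂P - e = ∫ ω, (ξ ω - e)⁺ ∂P - ∫ ω, (e - ξ ω)⁺ ∂P := by
  rw [← integral_sub (integrable_posPart_sub hi e) (integrable_posPart_sub' hi e)]
  have h : ∀ ω, (ξ ω - e)⁺ - (e - ξ ω)⁺ = ξ ω - e := fun ω => by
    rw [← neg_sub (ξ ω) e, posPart_neg, posPart_sub_negPart]
  simp_rw [h]
  rw [integral_sub hi (integrable_const _)]
  simp

theorem le_integral_tailExpectation [IsProbabilityMeasure P] (hξ : MemLp ξ ∞ P) {β e : ℝ}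
    (hβ : 0 ≤ β) (he : ∫ ω, (ξ ω - e)⁺ ∂P = β * ∫ ω, (e - ξ ω)⁺ ∂P)
    {ν : Measure ℝ} (hν : ν ∈ kusuokaSet β) :
    e ≤ ∫ α in Ioc (0 : ℝ) 1, tailExpectation P α ξ ∂ν := by
  obtain ⟨hν1, hν2, hν3⟩ := hν
  set M := ∫ ω, (e - ξ ω)⁺ ∂P with hM
  have hM0 : 0 ≤ M := integral_nonneg fun _ => posPart_nonneg _
  have hu : ν (Ioc (0 : ℝ) 1) = 1 := (prob_compl_eq_zero_iff measurableSet_Ioc).1 hν2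
  have hmeas : Measurable fun u : ℝ => 1 / u := measurable_const.div measurable_id
  have hpos : 0 ≤ᵐ[ν.restrict (Ioc 0 1)] fun u : ℝ => 1 / u := by
    filter_upwards [ae_restrict_mem measurableSet_Ioc] with u hu
    exact one_div_nonneg.2 hu.1.le
  have hfin : ENNReal.ofReal β * ν {1} ≠ ∞ :=
    ENNReal.mul_ne_top ENNReal.ofReal_ne_top (measure_ne_top _ _)
  have hint : Integrable (fun u : ℝ => 1 / u) (ν.restrict (Ioc 0 1)) :=
    ⟨hmeas.aestronglyMeasurable, by
      rw [hasFiniteIntegral_iff_ofReal hpos]; exact hν3.trans_lt hfin.lt_top⟩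
  have hle : ∫ u in Ioc (0 : ℝ) 1, 1 / u ∂ν ≤ β * ν.real {1} := by
    rw [integral_eq_lintegral_of_nonneg_ae hpos hmeas.aestronglyMeasurable]
    refine (ENNReal.toReal_mono hfin hν3).trans_eq ?_
    rw [ENNReal.toReal_mul, ENNReal.toReal_ofReal hβ]; rfl
  have hind : Integrable (({1} : Set ℝ).indicator fun _ => β * M) (ν.restrict (Ioc 0 1)) :=
    (integrable_const _).indicator (measurableSet_singleton 1)
  have hc : Integrable (fun _ : ℝ => e) (ν.restrict (Ioc 0 1)) := integrable_const e
  have hval : ∫ u in Ioc (0 : ℝ) 1, (({1} : Set ℝ).indicator (fun _ => β * M)) u ∂ν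
      = ν.real {1} * (β * M) := by
    rw [integral_indicator (measurableSet_singleton 1),
      Measure.restrict_restrict (measurableSet_singleton 1),
      inter_eq_left.2 (singleton_subset_iff.2 (by simp : (1 : ℝ) ∈ Ioc (0 : ℝ) 1))]
    simp [Measure.real]
  -- The indicator is the gain `β M` at the atom `1`, to be weighed against `M ∫ 1/u dν`.
  have key : ∫ u in Ioc (0 : ℝ) 1,
      ((e - M * (1 / u)) + (({1} : Set ℝ).indicator (fun _ => β * M)) u) ∂ν
      ≤ ∫ α in Ioc (0 : ℝ) 1, tailExpectation P α ξ ∂ν := by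
    refine setIntegral_mono_on ((hc.sub (hint.const_mul M)).add hind)
      (integrableOn_tailExpectation hξ ν) measurableSet_Ioc fun α hα => ?_
    by_cases h1 : α = 1
    · subst h1
      have := integral_sub_eq (hξ.integrable le_top) e
      rw [tailExpectation_one hξ]
      simp only [mem_singleton_iff, indicator_of_mem]
      rw [he] at this
      linarith
    · simpa [h1] using sub_le_tailExpectation hξ e hα
  rw [integral_add (f := fun u : ℝ => e - M * (1 / u)) (hc.sub (hint.const_mul M)) hind,
    integral_sub hc (hint.const_mul M),
    integral_const_mul, hval] at key
  have hce : ∫ _ in Ioc (0 : ℝ) 1, e ∂ν = e := by simp [Measure.real, hu]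
  rw [hce] at key
  nlinarith [mul_le_mul_of_nonneg_left hle hM0]

end

/-- The two-point measure on `{p, 1}` for which the constraint of `kusuokaSet β` is tight. -/
theorem exists_mem_kusuokaSet {β p : ℝ} (hβ : 1 ≤ β) (hp : p ∈ Ioc (0 : ℝ) 1) :
    ∃ ν ∈ kusuokaSet β, ∀ f : ℝ → ℝ, ∫ α in Ioc (0 : ℝ) 1, f α ∂ν
      = (1 + p * (β - 1))⁻¹ * (f 1 + p * (β - 1) * f p) := by
  have hq : 0 ≤ p * (β - 1) := mul_nonneg hp.1.le (by linarith)
  -- `q` is the ratio of the weight at `p` to that at `1`, found from `1 + q/p = β`.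
  set q := p * (β - 1) with hqdef
  have ha : 0 ≤ (1 + q)⁻¹ := by positivity
  have hb : 0 ≤ (1 + q)⁻¹ * q := by positivity
  set ν : Measure ℝ := ENNReal.ofReal (1 + q)⁻¹ • Measure.dirac 1 +
    ENNReal.ofReal ((1 + q)⁻¹ * q) • Measure.dirac p with hν
  have h1 : (1 : ℝ) ∈ Ioc (0 : ℝ) 1 := by simp
  have hres : ν.restrict (Ioc 0 1) = ν := by
    refine Measure.restrict_eq_self_of_ae_mem ?_
    rw [hν, ae_add_measure_iff]
    constructor <;> refine Measure.ae_smul_measure ?_ _ <;> rw [ae_dirac_iff (p := (· ∈ Ioc (0 : ℝ) 1)) measurableSet_Ioc]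
    · exact h1
    · exact hp
  refine ⟨ν, ⟨⟨?_⟩, ?_, ?_⟩, fun f => ?_⟩
  · simp only [hν, Measure.add_apply, Measure.smul_apply, measure_univ, smul_eq_mul, mul_one]
    rw [← ENNReal.ofReal_add ha hb, ← mul_one_add, inv_mul_cancel₀ (by positivity),
      ENNReal.ofReal_one]
  · rw [← hres, Measure.restrict_apply measurableSet_Ioc.compl, compl_inter_self, measure_empty]
  -- Only `≤`: for `p = 1` the two atoms merge.
  · have hν1 : ENNReal.ofReal (1 + q)⁻¹ ≤ ν {1} := by simp [hν]
    refine le_trans (le_of_eq ?_) (mul_le_mul_right hν1 (ENNReal.ofReal β))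
    rw [hres, hν, lintegral_add_measure, lintegral_smul_measure, lintegral_smul_measure,
      lintegral_dirac, lintegral_dirac, smul_eq_mul, smul_eq_mul, ← ENNReal.ofReal_mul ha,
      ← ENNReal.ofReal_mul hb, ← ENNReal.ofReal_mul (by linarith), ← ENNReal.ofReal_add
        (by positivity) (mul_nonneg hb (one_div_nonneg.2 hp.1.le))]
    congr 1
    have := hp.1.ne'
    rw [mul_assoc, ← mul_add, mul_comm β, hqdef]
    congr 1
    field_simp
    ring
  · have hd : ∀ x : ℝ, Integrable f (Measure.dirac x) := fun x => integrable_dirac (by simp)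
    rw [hres, hν, integral_add_measure ((hd 1).smul_measure ENNReal.ofReal_ne_top)
      ((hd p).smul_measure ENNReal.ofReal_ne_top), integral_smul_measure, integral_smul_measure,
      integral_dirac, integral_dirac, ENNReal.toReal_ofReal ha, ENNReal.toReal_ofReal hb,
      smul_eq_mul, smul_eq_mul]
    ring

theorem mainTheorem4 {Ω : Type*} [MeasurableSpace Ω] (P : Measure Ω) [IsProbabilityMeasure P]
    (hP : IsAtomless P) (τ : ℝ) (hτ : 0 < τ) (hτ' : τ ≤ 1 / 2)
    (ξ : Ω → ℝ) (hξ : MemLp ξ ∞ P) :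
    (∃! l : ℝ, IsMinOn (expectileLoss P τ ξ) univ l) ∧
    (∀ ν ∈ kusuokaSet ((1 - τ) / τ),
      IntegrableOn (fun α : ℝ => tailExpectation P α ξ) (Ioc 0 1) ν) ∧
    IsGLB ((fun ν : Measure ℝ => ∫ α in Ioc (0 : ℝ) 1, tailExpectation P α ξ ∂ν) ''
        kusuokaSet ((1 - τ) / τ))
      (expectile P τ ξ) := by
  obtain ⟨e, he⟩ := exists_balance hτ hτ' hξ
  have hiff := isMinOn_expectileLoss_iff hτ hτ' hξ he
  have hexp : expectile P τ ξ = e :=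
    (hiff _).1 (Classical.epsilon_spec (p := fun l => IsMinOn (expectileLoss P τ ξ) univ l)
      ⟨e, (hiff e).2 rfl⟩)
  have hβ : 1 ≤ (1 - τ) / τ := (one_le_div hτ).2 (by linarith)
  have he' : ∫ ω, (ξ ω - e)⁺ ∂P = (1 - τ) / τ * ∫ ω, (e - ξ ω)⁺ ∂P := by
    field_simp
    linarith
  refine ⟨⟨e, (hiff e).2 rfl, fun l hl => (hiff l).1 hl⟩, fun ν hν => ?_, ?_⟩
  · have := hν.1
    exact integrableOn_tailExpectation hξ ν
  rw [hexp]
  set β := (1 - τ) / τ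
  refine ⟨?_, fun c hc => ?_⟩
  · rintro _ ⟨ν, hν, rfl⟩
    exact le_integral_tailExpectation hξ (by linarith) he' hν
  have hmean := integral_sub_eq (hξ.integrable le_top) e
  rw [he'] at hmean
  set M := ∫ ω, (e - ξ ω)⁺ ∂P
  have hM0 : 0 ≤ M := integral_nonneg fun _ => posPart_nonneg _
  obtain ⟨p, hp, hpe⟩ := exists_tailExpectation_le hξ e
    (fun h => by rw [show M = 0 from h] at hmean; linarith)
  obtain ⟨ν, hν, hνf⟩ := exists_mem_kusuokaSet hβ hp
  refine (hc (mem_image_of_mem _ hν)).trans ?_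
  have hq : 0 ≤ p * (β - 1) := mul_nonneg hp.1.le (by linarith)
  have hp0 := hp.1.ne'
  simp only [hνf]
  rw [tailExpectation_one hξ, inv_mul_le_iff₀ (by linarith)]
  -- The excess `(β - 1) M` of `E ξ` over `e` cancels against `q M/p`, where `q = p(β - 1)`.
  have h1 := mul_le_mul_of_nonneg_left hpe hq
  have h2 : p * (β - 1) * (e - M * (1 / p)) = p * (β - 1) * e - (β - 1) * M := by
    field_simp
  linarith
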